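/- All groups are finite. A subgroup $H$ of a group $G$ is a T.I. subgroup if for every $x\in G$ the intersection $H\cap H^x$ is either $H$ or trivial, and a Hall subgroup of $K\ge H$ if $|H|$ is coprime to $|K:H|$. For a set $\pi$ of primes, $G$ is $\pi$-separable if it has a normal series each of whose factors is a $\pi$-group or a $\pi'$-group, and $O_{\pi'}(G)$ denotes the largest normal $\pi'$-subgroup of $G$. A group $NK$ is a Frobenius group with kernel $N$ and complement $K$ if $N$ and $K$ are nontrivial, $NK=N\rtimes K$, and every nonidentity element of $K$ acts fixed point freely on $N$ by conjugation. A group $L$ is a double Frobenius group with factors $A,B,C$ if $L=(A\rtimes B)\rtimes C$, where $AB$ is a Frobenius group with kernel $A$ and complement $B$, and $BC$ is a Frobenius group with kernel $B$ and complement $C$. **Theorem.** Let $G$ be a finite group, let $H$ be a nonnormal T.I. subgroup of $G$, and let $\pi$ be the set of primes dividing $|H|$. Assume that $G$ is $\pi$-separable and that $H$ is a Hall subgroup of $N_G(H)$. Let $Q$ be any complement of $H$ in $N_G(H)$ (that is, $N_G(H)=HQ$ and $H\cap Q=1$), and put $O=O_{\pi'}(G)$ and $O'=[O,O]$. Assume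 further that $|H|$ is odd, $[O,H]=O$, $O$ is solvable, and $Q\not\le O'$. Let $\overline{G}=G/O'$, and write $\overline{X}$ for the image of a subgroup $X$ of $G$ in $\overline{G}$. Then: (a) $\overline{G}=(\overline{O}\rtimes\overline{H})\rtimes\overline{Q}$; (b) $\overline{Q}$ is abelian, normalizes $\overline{H}$, and acts faithfully on $\overline{H}$ by conjugation; (c) for every $\beta\in\overline{Q}$ of prime order, $\overline{O}\,[\overline{H},\beta]\,\langle\beta\rangle$ is a double Frobenius group with factors $\overline{O}$, $[\overline{H},\beta]$ and $\langle\beta\rangle$. -/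

import Mathlib

open scoped Pointwise

/-- `n` is a `π`-number: every prime divisor of `n` lies in `π`. -/
def IsPiNumber (π : Set ℕ) (n : ℕ) : Prop :=
  ∀ p : ℕ, p.Prime → p ∣ n → p ∈ π

/-- The set of primes dividing the order of the subgroup `H`. -/
def Subgroup.primeDivisors {G : Type*} [Group G] (H : Subgroup G) : Set ℕ :=
  {p : ℕ | p.Prime ∧ p ∣ Nat.card H}

/-- A finite group `G` is `π`-separable: it has a normal series
`1 = N 0 ≤ N 1 ≤ ⋯ ≤ N n = G` each of whose factors is a `π`-group or a `π'`-group. -/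
def IsPiSeparable (π : Set ℕ) (G : Type*) [Group G] : Prop :=
  ∃ (n : ℕ) (N : ℕ → Subgroup G),
    N 0 = ⊥ ∧ N n = ⊤ ∧ (∀ i, i ≤ n → (N i).Normal) ∧
    ∀ i, i < n → N i ≤ N (i + 1) ∧
      (IsPiNumber π ((N i).relIndex (N (i + 1))) ∨
        IsPiNumber πᶜ ((N i).relIndex (N (i + 1))))

/-- `O_π(G)`: the subgroup generated by all normal `π`-subgroups of `G`; in a finite group it is
the largest normal `π`-subgroup. -/
def piCore (π : Set ℕ) (G : Type*) [Group G] : Subgroup G :=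
  sSup {N : Subgroup G | N.Normal ∧ IsPiNumber π (Nat.card N)}

instance piCore_normal (π : Set ℕ) (G : Type*) [Group G] : (piCore π G).Normal := by
  refine Subgroup.normalizer_eq_top_iff.mp (top_unique fun g _ => ?_)
  have key : ∀ g : G, (piCore π G).map (MulAut.conj g).toMonoidHom ≤ piCore π G := by
    intro g
    rw [Subgroup.map_le_iff_le_comap]
    refine sSup_le fun N hN => ?_
    intro x hx
    exact (le_sSup hN : N ≤ piCore π G) (hN.1.conj_mem x hx g)
  rw [Subgroup.mem_normalizer_iff]
  intro x
  refine ⟨fun hx => key g ⟨x, hx, rfl⟩, fun hx => ?_⟩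
  have h := key g⁻¹ ⟨_, hx, rfl⟩
  simpa [mul_assoc] using h

/-- `O_{π'}(G)`, where `π` is the set of primes dividing the order of the subgroup `H` of `G`. -/
abbrev Subgroup.piPrimeCore {G : Type*} [Group G] (H : Subgroup G) : Subgroup G :=
  piCore (H.primeDivisors)ᶜ G

namespace Subgroup

variable {G : Type*} [Group G]

/-- `H` is a T.I. subgroup: each conjugate `x H x⁻¹` meets `H` in `H` or in the trivial group. -/
def IsTI (H : Subgroup G) : Prop :=
  ∀ x : G, H ⊓ MulAut.conj x • H = H ∨ H ⊓ MulAut.conj x • H = ⊥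

/-- `H` is a Hall subgroup of the subgroup `K`: `H ≤ K` and `|H|` is coprime to `|K : H|`. -/
def IsHallIn (H K : Subgroup G) : Prop :=
  H ≤ K ∧ (Nat.card H).Coprime (H.relIndex K)

/-- `Q` is a complement of `H` in the subgroup `K`: `H` and `Q` are subgroups of `K` with
`H ∩ Q = 1` and `K = HQ`. -/
def IsComplementIn (Q H K : Subgroup G) : Prop :=
  H ≤ K ∧ Q ≤ K ∧ H ⊓ Q = ⊥ ∧ (H : Set G) * (Q : Set G) = (K : Set G)

/-- `L = N ⋊ K` as an internal semidirect product of subgroups: `N` and `K` are subgroups of `L`,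
`N` is normal in `L`, `N ∩ K = 1` and `L = NK`. -/
def IsInternalSemidirect (L N K : Subgroup G) : Prop :=
  IsComplementIn K N L ∧ ∀ x ∈ L, ∀ n ∈ N, x * n * x⁻¹ ∈ N

/-- `Q` acts on `H` by conjugation (that is, it normalizes `H`) and this action is faithful. -/
def ActsFaithfullyOn (Q H : Subgroup G) : Prop :=
  (∀ q ∈ Q, ∀ h ∈ H, q * h * q⁻¹ ∈ H) ∧
    ∀ q ∈ Q, (∀ h ∈ H, q * h * q⁻¹ = h) → q = 1

/-- `L` is a Frobenius group with kernel `N` and complement `K`: `N` and `K` are nontrivial,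
`L = N ⋊ K`, and every nonidentity element of `K` acts fixed point freely on `N`. -/
def IsFrobeniusGroup (L N K : Subgroup G) : Prop :=
  N ≠ ⊥ ∧ K ≠ ⊥ ∧ IsInternalSemidirect L N K ∧
    ∀ k ∈ K, k ≠ 1 → ∀ n ∈ N, k * n * k⁻¹ = n → n = 1

/-- `L` is a double Frobenius group with factors `A`, `B`, `C`: `L = (A ⋊ B) ⋊ C`, where `AB` is a
Frobenius group with kernel `A` and complement `B`, and `BC` is a Frobenius group with kernel `B`
and complement `C`. -/
def IsDoubleFrobeniusGroup (L A B C : Subgroup G) : Prop :=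
  IsInternalSemidirect L (A ⊔ B) C ∧
    IsFrobeniusGroup (A ⊔ B) A B ∧ IsFrobeniusGroup (B ⊔ C) B C

end Subgroup

/-!
A nontrivial subgroup of a T.I. subgroup `H` has its normalizer inside `N(H)`, so the Sylow
subgroups of `H` are Sylow subgroups of `G`. By `π`-separability some normal `M > O` has `M / O` a
`π`-group; the Frattini argument in `M` gives `G = N(H) M`, and as `|G : N(H)|` is prime to `|H|`
even `G = N(H) O`. The only elements of `O` normalizing `H` lie in `O'`: they centralize `H`, and
the fixed points of `H` in the abelian group `O / O'` meet `[O, H] O' / O' = O / O'` trivially.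
Since fixed points of coprime automorphisms lift, `H` acts fixed-point-freely on `O / O'`, and as
`|H|` is odd this forces the Sylow subgroups of `H` to be cyclic.

Such a group `H` has a cyclic subgroup `F` (the centralizer of `[H, H]`), self-centralizing in `H`
and normalized by `N(H)`. As `Aut F` is abelian, `[H, Q] ≤ F`, so `H = F C_H(β)` for each `β ∈ Q` of
prime order; hence `Q` is faithful on `F`, so abelian, and `[H, β] = [F, β]` meets `C(β)` trivially.
Faithfulness of `Q` on `H` modulo `O'` holds because `(O / O') C_Q(H)` is a normal `π'`-subgroup.
-/

section

open Subgroup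
open scoped commutatorElement

variable {G : Type*} [Group G]

theorem exists_mem_orderOf_prime_of_ne_bot {K : Subgroup G} [Finite K] (hK : K ≠ ⊥) :
    ∃ k ∈ K, (orderOf k).Prime := by
  obtain ⟨p, hp, hpK⟩ := Nat.exists_prime_and_dvd (mt card_eq_one.mp hK)
  have := Fact.mk hp
  obtain ⟨k, hk⟩ := exists_prime_orderOf_dvd_card' (G := K) p hpK
  exact ⟨k, k.2, by rwa [orderOf_coe, hk]⟩

theorem inf_eq_bot_of_coprime_card {A B : Subgroup G} [Finite A]
    (h : (Nat.card A).Coprime (Nat.card B)) : A ⊓ B = ⊥ :=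
  disjoint_iff.mp (disjoint_of_coprime_natCard h)

/-! ### Cyclic `p`-groups -/

theorem mul_pow_of_commutatorElement_mem_center {x y : G} (hc : ⁅y⁻¹, x⁻¹⁆ ∈ center G) (n : ℕ) :
    (x * y) ^ n = x ^ n * y ^ n * ⁅y⁻¹, x⁻¹⁆ ^ n.choose 2 := by
  set c := ⁅y⁻¹, x⁻¹⁆ with hcdef
  have hyx : y * x = x * y * c := by rw [hcdef, commutatorElement_def]; group
  have hcomm (k : ℕ) (z : G) : c ^ k * z = z * c ^ k := (mem_center_iff.mp (pow_mem hc k) z).symm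
  have hpow_mul (n : ℕ) : y ^ n * x = x * y ^ n * c ^ n := by
    induction n with
    | zero => simp
    | succ n ih =>
      calc y ^ (n + 1) * x = (y ^ n * x) * y * c := by rw [pow_succ, mul_assoc, hyx]; group
        _ = x * y ^ n * (c ^ n * y) * c := by rw [ih]; group
        _ = x * y ^ (n + 1) * c ^ (n + 1) := by rw [hcomm]; simp only [pow_succ, mul_assoc]
  induction n with
  | zero => simp
  | succ n ih =>
    calc (x * y) ^ (n + 1) = x ^ n * y ^ n * (c ^ n.choose 2 * (x * y)) := by
          rw [pow_succ, ih, mul_assoc _ (c ^ _)]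
      _ = x ^ n * (y ^ n * x) * y * c ^ n.choose 2 := by rw [hcomm]; group
      _ = x ^ (n + 1) * y ^ n * (c ^ n * y) * c ^ n.choose 2 := by
          rw [hpow_mul]; simp only [pow_succ, mul_assoc]
      _ = x ^ (n + 1) * y ^ (n + 1) * (c ^ n * c ^ n.choose 2) := by
          rw [hcomm]; simp only [pow_succ, mul_assoc]
      _ = _ := by rw [← pow_add, Nat.choose_succ_succ' n 1, Nat.choose_one_right]

theorem mul_pow_of_odd_of_pow_mem_center {n : ℕ} (hn : Odd n) {x y : G}
    (hc : ⁅y⁻¹, x⁻¹⁆ ∈ center G) (hy : y ^ n ∈ center G) : (x * y) ^ n = x ^ n * y ^ n := by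
  have hconj : x⁻¹ * y * x = y * ⁅y⁻¹, x⁻¹⁆ := by rw [commutatorElement_def]; group
  have hcn : ⁅y⁻¹, x⁻¹⁆ ^ n = 1 := by
    have hcomm : Commute y ⁅y⁻¹, x⁻¹⁆ := mem_center_iff.mp hc y
    have hpow : (x⁻¹ * y * x) ^ n = y ^ n := by
      have := conj_pow (i := n) (a := x⁻¹) (b := y)
      rwa [inv_inv, mem_center_iff.mp hy, inv_mul_cancel_right] at this
    rwa [hconj, hcomm.mul_pow, mul_eq_left] at hpow
  obtain ⟨k, rfl⟩ := hn
  rw [mul_pow_of_commutatorElement_mem_center hc, Nat.choose_two_right, Nat.add_sub_cancel,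
    mul_left_comm, Nat.mul_div_cancel_left _ two_pos, pow_mul, hcn, one_pow, mul_one]

theorem commutator_le_of_index_prime {M : Subgroup G} [M.Normal] (hM : M.index.Prime) :
    _root_.commutator G ≤ M := by
  have := Fact.mk hM
  have : IsCyclic (G ⧸ M) := isCyclic_of_prime_card M.index_eq_card.symm
  exact Normal.quotient_commutative_iff_commutator_le.mp inferInstance

theorem isCoatom_of_index_prime {M : Subgroup G} (hM : M.index.Prime) : IsCoatom M := by
  refine ⟨fun h => hM.ne_one (index_eq_one.mpr h), fun K hMK => ?_⟩
  rw [← relIndex_mul_index hMK.le] at hM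
  refine (Nat.prime_mul_iff.mp hM).elim (fun h => index_eq_one.mp h.2) fun h => ?_
  exact absurd (relIndex_eq_one.mp h.2) hMK.not_ge

theorem inf_le_center_of_sup_eq_top {M N : Subgroup G} [IsMulCommutative M] [IsMulCommutative N]
    (h : M ⊔ N = ⊤) : M ⊓ N ≤ center G := by
  have hle : M ⊔ N ≤ centralizer (M ⊓ N : Subgroup G) :=
    sup_le (M.le_centralizer.trans (centralizer_le inf_le_left))
      (N.le_centralizer.trans (centralizer_le inf_le_right))
  rwa [h, le_centralizer_iff, coe_top, centralizer_univ] at hle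

theorem card_le_card_mul_card_of_mul_pow [Finite G] {n : ℕ} {K L : Subgroup G}
    (hmul : ∀ x y : G, (x * y) ^ n = x ^ n * y ^ n) (hK : ∀ x : G, x ^ n = 1 → x ∈ K)
    (hL : ∀ x : G, x ^ n ∈ L) : Nat.card G ≤ Nat.card K * Nat.card L := by
  let f : G →* G := MonoidHom.mk' (· ^ n) hmul
  have hrange : f.range ≤ L := by
    rintro _ ⟨x, rfl⟩
    exact hL x
  rw [← f.ker.card_mul_index, index_ker]
  exact Nat.mul_le_mul (card_le_of_le hK) (card_le_of_le hrange)

theorem exists_ne_of_not_isCyclic_of_card_eq_prime_pow [Finite G] {p n : ℕ} [hp : Fact p.Prime]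
    (hcard : Nat.card G = p ^ (n + 1)) (hcyc : ¬ IsCyclic G) :
    ∃ M N : Subgroup G, M ≠ N ∧ Nat.card M = p ^ n ∧ Nat.card N = p ^ n := by
  have hdvd : p ^ n ∣ Nat.card G := hcard ▸ pow_dvd_pow p n.le_succ
  obtain ⟨M, hM⟩ := Sylow.exists_subgroup_card_pow_prime p hdvd
  obtain ⟨g, -, hg⟩ : ∃ g ∈ (⊤ : Subgroup G), g ∉ M := by
    refine SetLike.not_le_iff_exists.mp fun h => ?_
    rw [top_le_iff.mp h, card_top, hcard] at hM
    exact (Nat.pow_lt_pow_succ hp.out.one_lt).ne' hM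
  obtain ⟨k, hk, hkg⟩ := (Nat.dvd_prime_pow hp.out).mp (hcard ▸ orderOf_dvd_natCard g)
  have hkn : k ≤ n := by
    refine Nat.le_of_lt_succ (hk.lt_of_ne ?_)
    rintro rfl
    exact hcyc (isCyclic_of_orderOf_eq_card g (hkg.trans hcard.symm))
  obtain ⟨N, hN, hgN⟩ :=
    Sylow.exists_subgroup_card_pow_prime_le p hdvd (zpowers g) (Nat.card_zpowers g ▸ hkg) hkn
  exact ⟨M, N, fun h => hg (h ▸ hgN (mem_zpowers g)), hM, hN⟩

theorem normal_and_index_eq_of_card_eq_prime_pow [Finite G] {p n : ℕ} [hp : Fact p.Prime]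
    (hcard : Nat.card G = p ^ (n + 1)) {M : Subgroup G} (hM : Nat.card M = p ^ n) :
    M.Normal ∧ M.index = p := by
  have hindex : M.index = p := by
    have := M.card_mul_index
    rw [hM, hcard, pow_succ] at this
    exact Nat.eq_of_mul_eq_mul_left (pow_pos hp.out.pos n) this
  refine ⟨normal_of_index_eq_minFac_card ?_, hindex⟩
  rw [hindex, hcard, hp.out.pow_minFac n.succ_ne_zero]

theorem exists_orderOf_eq_forall_pow_eq_one_mem_zpowers [Finite G] [Nontrivial G] {p : ℕ}
    [hp : Fact p.Prime] (hG : IsPGroup p G)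
    (h : ∀ x y : G, Commute x y → orderOf x = p → orderOf y = p → x ∈ zpowers y) :
    ∃ z : G, orderOf z = p ∧ ∀ x : G, x ^ p = 1 → x ∈ zpowers z := by
  have := hG.center_nontrivial
  obtain ⟨n, hn, hcard⟩ := (hG.to_subgroup (center G)).nontrivial_iff_card.mp inferInstance
  obtain ⟨z, hz⟩ := exists_prime_orderOf_dvd_card' (G := center G) p
    (hcard ▸ dvd_pow_self p hn.ne')
  refine ⟨z, by rwa [orderOf_coe], fun x hx => ?_⟩
  rcases eq_or_ne x 1 with rfl | hx1
  · exact one_mem _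
  · exact h x z (mem_center_iff.mp z.2 x) (orderOf_eq_prime hx hx1) (by rwa [orderOf_coe])

theorem isCyclic_of_odd_prime_pow_card {p : ℕ} [hp : Fact p.Prime] (hodd : Odd p) {n : ℕ}
    [Finite G] (hcard : Nat.card G = p ^ n)
    (h : ∀ x y : G, Commute x y → orderOf x = p → orderOf y = p → x ∈ zpowers y) :
    IsCyclic G := by
  induction n generalizing G with
  | zero =>
    have := (Nat.card_eq_one_iff_unique.mp hcard).1
    infer_instance
  | succ n ih =>
    by_contra hcyc
    obtain ⟨M, N, hMN, hM, hN⟩ := exists_ne_of_not_isCyclic_of_card_eq_prime_pow hcard hcyc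
    obtain ⟨_, hMp⟩ := normal_and_index_eq_of_card_eq_prime_pow hcard hM
    obtain ⟨_, hNp⟩ := normal_and_index_eq_of_card_eq_prime_pow hcard hN
    have hcyclic {L : Subgroup G} (hL : Nat.card L = p ^ n) : IsCyclic L := by
      refine ih hL fun x y hxy hx hy => ?_
      have := h x y (congrArg Subtype.val hxy) (by rwa [orderOf_coe]) (by rwa [orderOf_coe])
      rwa [← coe_subtype, ← MonoidHom.map_zpowers, ← mem_comap,
        comap_map_eq_self_of_injective L.subtype_injective] at this
    have := hcyclic hM
    have := hcyclic hN
    have hcenter : M ⊓ N ≤ center G := inf_le_center_of_sup_eq_top <|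
      (isCoatom_of_index_prime (hMp ▸ hp.out)).sup_eq_top_of_ne
        (isCoatom_of_index_prime (hNp ▸ hp.out)) hMN
    have hpow (x : G) : x ^ p ∈ M ⊓ N :=
      ⟨hMp ▸ M.pow_index_mem x, hNp ▸ N.pow_index_mem x⟩
    have hcomm : _root_.commutator G ≤ M ⊓ N := le_inf
      (commutator_le_of_index_prime (hMp ▸ hp.out)) (commutator_le_of_index_prime (hNp ▸ hp.out))
    have hmul (x y : G) : (x * y) ^ p = x ^ p * y ^ p := mul_pow_of_odd_of_pow_mem_center hodd
      (hcenter (hcomm (commutator_mem_commutator (mem_top _) (mem_top _)))) (hcenter (hpow y))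
    have : Nontrivial G := Finite.one_lt_card_iff_nontrivial.mp
      (hcard ▸ one_lt_pow₀ hp.out.one_lt n.succ_ne_zero)
    obtain ⟨z, hz, hpz⟩ :=
      exists_orderOf_eq_forall_pow_eq_one_mem_zpowers (IsPGroup.of_card hcard) h
    have hle : p ^ n ≤ Nat.card (M ⊓ N : Subgroup G) := by
      have := card_le_card_mul_card_of_mul_pow hmul hpz hpow
      rw [hcard, Nat.card_zpowers, hz, pow_succ'] at this
      exact Nat.le_of_mul_le_mul_left this hp.out.pos
    exact hMN ((eq_of_le_of_card_ge inf_le_left (hM ▸ hle)).symm.trans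
      (eq_of_le_of_card_ge inf_le_right (hN ▸ hle)))

/-! ### Fixed points of automorphisms -/

theorem exists_commute_of_commutatorElement_mem {p n : ℕ} [hp : Fact p.Prime] {M : Subgroup G}
    [Finite M] (hpM : ¬ p ∣ Nat.card M) {g x : G} (hg : g ^ p ^ n = 1)
    (hgM : g ∈ normalizer (M : Set G)) (hx : ⁅x⁻¹, g⁆ ∈ M) :
    ∃ c, x⁻¹ * c ∈ M ∧ Commute g c := by
  let τ : Equiv.Perm G := MulAut.toPerm G (MulAut.conj g)
  have hτ : τ ^ p ^ n = 1 := by rw [← map_pow, ← map_pow, hg, map_one, map_one]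
  have hτM (y : G) : x⁻¹ * τ y ∈ M ↔ x⁻¹ * y ∈ M := by
    have : x⁻¹ * τ y = ⁅x⁻¹, g⁆ * (g * (x⁻¹ * y) * g⁻¹) := by
      change x⁻¹ * (g * y * g⁻¹) = _
      rw [commutatorElement_def]
      group
    rw [this, M.mul_mem_cancel_left hx, ← mem_normalizer_iff.mp hgM]
  let e : {y // x⁻¹ * y ∈ M} ≃ M := (Equiv.mulLeft x⁻¹).subtypeEquiv fun _ => Iff.rfl
  have := Finite.of_equiv M e.symm
  have := Fintype.ofFinite {y // x⁻¹ * y ∈ M}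
  let σ : Equiv.Perm {y // x⁻¹ * y ∈ M} :=
    Equiv.Perm.subtypePerm (p := fun y => x⁻¹ * y ∈ M) τ hτM
  have hσ : σ ^ p ^ n = 1 := by
    rw [Equiv.Perm.subtypePerm_pow]
    exact Equiv.ext fun y => Subtype.ext (Equiv.congr_fun hτ y.1)
  obtain ⟨c, hc⟩ := Equiv.Perm.exists_fixed_point_of_prime
    (by rwa [← Nat.card_eq_fintype_card, Nat.card_congr e]) hσ
  exact ⟨c, c.2, mul_inv_eq_iff_eq_mul.mp (congrArg Subtype.val hc)⟩

theorem le_sup_inf_centralizer {F H : Subgroup G} [Finite F] {β : G} (hβ : (orderOf β).Prime)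
    (hcop : (Nat.card F).Coprime (orderOf β)) (hβF : β ∈ normalizer (F : Set G)) (hFH : F ≤ H)
    (hHF : ⁅H, zpowers β⁆ ≤ F) : H ≤ F ⊔ H ⊓ centralizer {β} := by
  intro h hh
  have := Fact.mk hβ
  obtain ⟨c, hc, hcomm⟩ := exists_commute_of_commutatorElement_mem (p := orderOf β) (n := 1)
    (hβ.coprime_iff_not_dvd.mp hcop.symm) (by rw [pow_one, pow_orderOf_eq_one]) hβF
    (hHF (commutator_mem_commutator (inv_mem hh) (mem_zpowers β)))
  have hcH : c ∈ H := (H.mul_mem_cancel_left (inv_mem hh)).mp (hFH hc)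
  have hch : c⁻¹ * h ∈ F := by simpa only [mul_inv_rev, inv_inv] using inv_mem hc
  rw [← mul_inv_cancel_left c h, sup_comm]
  exact mul_mem_sup ⟨hcH, mem_centralizer_singleton_iff.mpr hcomm.eq.symm⟩ hch

section Automorphisms

variable {A K : Type*} [CommGroup A] [Group K]

/-- The norm map `a ↦ ∏ k, k a` of a finite group `K` acting on an abelian group `A`. -/
def actionNorm [Fintype K] (φ : K →* MulAut A) : A →* A :=
  ∏ k, (φ k).toMonoidHom

theorem actionNorm_apply [Fintype K] (φ : K →* MulAut A) (a : A) : actionNorm φ a = ∏ k, φ k a :=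
  MonoidHom.finsetProd_apply _ _ _

theorem actionNorm_apply_apply [Fintype K] (φ : K →* MulAut A) (k : K) (a : A) :
    actionNorm φ (φ k a) = actionNorm φ a := by
  rw [actionNorm_apply, actionNorm_apply]
  refine Fintype.prod_equiv (Equiv.mulRight k) _ _ fun l => ?_
  rw [Equiv.coe_mulRight, map_mul, MulAut.mul_apply]

theorem actionNorm_apply_of_forall_apply_eq [Fintype K] {φ : K →* MulAut A} {a : A}
    (ha : ∀ k, φ k a = a) : actionNorm φ a = a ^ Nat.card K := by
  simp only [actionNorm_apply, ha, Finset.prod_const, Finset.card_univ, Nat.card_eq_fintype_card]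

theorem prod_range_pow_apply_eq_one [Finite A] {σ : MulAut A} {n : ℕ}
    (hσ : MonoidHom.FixedPointFree σ) (hn : σ ^ n = 1) (a : A) :
    ∏ i ∈ Finset.range n, (σ ^ i) a = 1 := by
  have hiterate (k : ℕ) : ⇑(σ ^ k) = σ^[k] :=
    hom_coe_pow (fun τ : MulAut A => ⇑τ) rfl (fun _ _ => rfl) σ k
  simp only [hiterate]
  exact hσ.prod_pow_eq_one (hiterate n ▸ hn ▸ rfl) a

theorem not_dvd_card_of_fixedPointFree {A : Type*} [Group A] [Finite A] {σ : MulAut A} {p n : ℕ}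
    [Fact p.Prime] (hσ : MonoidHom.FixedPointFree σ) (hn : σ ^ p ^ n = 1) : ¬ p ∣ Nat.card A := by
  have := Fintype.ofFinite A
  intro hp
  rw [Nat.card_eq_fintype_card] at hp
  obtain ⟨a, ha, ha1⟩ := Equiv.Perm.exists_fixed_point_of_prime' hp
    (σ := MulAut.toPerm A σ) (n := n) (by rw [← map_pow, hn, map_one]) (a := 1) (map_one σ)
  exact ha1 (hσ a ha)

/-- Evaluate `∏ (x * y ^ j) ^ i • a` over `i, j < p` in both orders: for fixed `j` the product is a
norm of `x * y ^ j`, hence trivial, while for fixed `i ≠ 0` it is a norm of `y ^ i`. Only the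
terms with `i = 0` remain, so `a ^ p = 1`. -/
theorem mem_zpowers_of_fixedPointFree [Finite A] [Nontrivial A] {φ : K →* MulAut A}
    (hφ : ∀ k ≠ 1, MonoidHom.FixedPointFree (φ k)) {p : ℕ} [hp : Fact p.Prime] {x y : K}
    (hxy : Commute x y) (hx : orderOf x = p) (hy : orderOf y = p) : x ∈ zpowers y := by
  by_contra hxmem
  have hnorm {g : K} (hg : g ≠ 1) (hgp : g ^ p = 1) (a : A) :
      ∏ i ∈ Finset.range p, φ (g ^ i) a = 1 := by
    simp only [map_pow]
    exact prod_range_pow_apply_eq_one (hφ g hg) (by rw [← map_pow, hgp, map_one]) a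
  have hxp : x ^ p = 1 := hx ▸ pow_orderOf_eq_one x
  have hyp (i : ℕ) : (y ^ i) ^ p = 1 := by rw [pow_right_comm, ← hy, pow_orderOf_eq_one, one_pow]
  have hrows (a : A) :
      ∏ i ∈ Finset.range p, ∏ j ∈ Finset.range p, φ ((x * y ^ j) ^ i) a = 1 := by
    rw [Finset.prod_comm]
    refine Finset.prod_eq_one fun j _ => hnorm (fun h => hxmem ?_) ?_ a
    · exact mul_eq_one_iff_eq_inv.mp h ▸ inv_mem (pow_mem (mem_zpowers y) j)
    · rw [(hxy.pow_right j).mul_pow, hxp, hyp, one_mul]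
  have hcolumn (a : A) {i : ℕ} (hi : i ∈ Finset.range p) (hi0 : i ≠ 0) :
      ∏ j ∈ Finset.range p, φ ((x * y ^ j) ^ i) a = 1 := by
    have hsplit (j : ℕ) : φ ((x * y ^ j) ^ i) a = φ (x ^ i) (φ ((y ^ i) ^ j) a) := by
      rw [(hxy.pow_right j).mul_pow, pow_right_comm, map_mul, MulAut.mul_apply]
    have hyi : y ^ i ≠ 1 := pow_ne_one_of_lt_orderOf hi0 (hy ▸ Finset.mem_range.mp hi)
    simp only [hsplit]
    rw [← map_prod, hnorm hyi (hyp i), map_one]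
  have hpow (a : A) : a ^ p = 1 := by
    rw [← hrows a, Finset.prod_eq_single_of_mem 0 (Finset.mem_range.mpr hp.out.pos)
      fun i hi hi0 => hcolumn a hi hi0]
    simp
  obtain ⟨a, ha⟩ := exists_ne (1 : A)
  have hy1 : y ≠ 1 := fun h => hp.out.ne_one (by rw [← hy, h, orderOf_one])
  refine not_dvd_card_of_fixedPointFree (p := p) (n := 1) (hφ y hy1) ?_ ?_
  · rw [pow_one, ← map_pow, ← hy, pow_orderOf_eq_one, map_one]
  · exact orderOf_eq_prime (hpow a) ha ▸ orderOf_dvd_natCard a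

theorem isZGroup_of_fixedPointFree [Finite A] [Nontrivial A] [Finite K] {φ : K →* MulAut A}
    (hφ : ∀ k ≠ 1, MonoidHom.FixedPointFree (φ k)) (h2 : ∀ P : Sylow 2 K, IsCyclic P) :
    IsZGroup K := by
  refine ⟨fun p hp P => ?_⟩
  have := Fact.mk hp
  rcases hp.eq_two_or_odd' with rfl | hodd
  · exact h2 P
  obtain ⟨n, hn⟩ := IsPGroup.iff_card.mp P.isPGroup'
  refine isCyclic_of_odd_prime_pow_card hodd hn fun x y hxy hx hy => ?_
  exact mem_zpowers_of_fixedPointFree (φ := φ.comp (P : Subgroup K).subtype)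
    (fun k hk => hφ k (by simpa using hk)) hxy hx hy

end Automorphisms

open scoped IsMulCommutative in
theorem commutator_inf_centralizer_eq_bot {A K : Subgroup G} [IsMulCommutative A] [Finite A]
    [Finite K] (hK : K ≤ normalizer (A : Set G)) (hcop : (Nat.card A).Coprime (Nat.card K)) :
    ⁅A, K⁆ ⊓ centralizer (K : Set G) = ⊥ := by
  have := Fintype.ofFinite K
  let φ : K →* MulAut A := A.normalizerMonoidHom.comp (inclusion hK)
  have hle : ⁅A, K⁆ ≤ (actionNorm φ).ker.map A.subtype := by
    refine commutator_le.mpr fun a ha k hk => ⟨⟨a, ha⟩ * φ ⟨k, hk⟩ ⟨a, ha⟩⁻¹, ?_, ?_⟩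
    · rw [SetLike.mem_coe, MonoidHom.mem_ker, map_mul, actionNorm_apply_apply, map_inv,
        mul_inv_cancel]
    · change a * (k * a⁻¹ * k⁻¹) = ⁅a, k⁆
      rw [commutatorElement_def]
      group
  rw [eq_bot_iff]
  rintro _ ⟨hmem, hfix⟩
  obtain ⟨a, ha, rfl⟩ := hle hmem
  have hφa (k : K) : φ k a = a :=
    Subtype.ext (mul_inv_eq_iff_eq_mul.mpr (mem_centralizer_iff.mp hfix k k.2))
  have hpow := pow_gcd_eq_one.mpr
    ⟨pow_card_eq_one' (x := a), (actionNorm_apply_of_forall_apply_eq hφa).symm.trans ha⟩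
  rw [hcop.gcd_eq_one, pow_one] at hpow
  rw [hpow, map_one]
  exact one_mem _

/-! ### Frobenius actions -/

/-- No nontrivial element of `K` commutes with a nontrivial element of `N`. When `K` normalizes
`N`, this says that every nontrivial element of `K` acts fixed point freely on `N` by
conjugation. -/
def ActsFixedPointFreelyOn (K N : Subgroup G) : Prop :=
  ∀ k ∈ K, k ≠ 1 → N ⊓ centralizer {k} = ⊥

theorem ActsFixedPointFreelyOn.mono_left {J K N : Subgroup G} (h : ActsFixedPointFreelyOn K N)
    (hJK : J ≤ K) : ActsFixedPointFreelyOn J N :=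
  fun k hk => h k (hJK hk)

theorem centralizer_singleton_le_of_mem_zpowers {g k : G} (h : k ∈ zpowers g) :
    centralizer {g} ≤ centralizer {k} := by
  obtain ⟨n, rfl⟩ := mem_zpowers_iff.mp h
  intro x hx
  have hcomm : Commute g x := (mem_centralizer_singleton_iff.mp hx).symm
  exact mem_centralizer_singleton_iff.mpr (hcomm.zpow_left n).symm.eq

theorem actsFixedPointFreelyOn_of_orderOf_prime {K N : Subgroup G} [Finite K]
    (h : ∀ k ∈ K, (orderOf k).Prime → N ⊓ centralizer {k} = ⊥) : ActsFixedPointFreelyOn K N := by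
  intro k hk hk1
  have hkK : zpowers k ≤ K := zpowers_le.mpr hk
  have : Finite (zpowers k) := Finite.of_injective _ (inclusion_injective hkK)
  obtain ⟨j, hj, hjp⟩ := exists_mem_orderOf_prime_of_ne_bot (mt zpowers_eq_bot.mp hk1)
  exact eq_bot_mono (inf_le_inf_left N (centralizer_singleton_le_of_mem_zpowers hj))
    (h j (hkK hj) hjp)

theorem actsFixedPointFreelyOn_zpowers {N : Subgroup G} {g : G} (hg : (orderOf g).Prime)
    (h : N ⊓ centralizer {g} = ⊥) : ActsFixedPointFreelyOn (zpowers g) N := by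
  intro k hk hk1
  have hgk : g ∈ zpowers k := by
    have hprime : (Nat.card (zpowers g)).Prime := by rwa [Nat.card_zpowers]
    have := Fact.mk hprime
    have := mem_zpowers_of_prime_card (p := Nat.card (zpowers g)) rfl
      (g := ⟨k, hk⟩) (g' := ⟨g, mem_zpowers g⟩) (mt (congrArg Subtype.val) hk1)
    obtain ⟨n, hn⟩ := this
    exact ⟨n, congrArg Subtype.val hn⟩
  exact eq_bot_mono (inf_le_inf_left N (centralizer_singleton_le_of_mem_zpowers hgk)) h

open scoped IsMulCommutative in
theorem ActsFixedPointFreelyOn.isZGroup {A H : Subgroup G} [IsMulCommutative A] [Finite A]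
    [Finite H] (h : ActsFixedPointFreelyOn H A) (hA : A ≠ ⊥) (hH : H ≤ normalizer (A : Set G))
    (h2 : ∀ P : Sylow 2 H, IsCyclic P) : IsZGroup H := by
  have : Nontrivial A := (nontrivial_iff_ne_bot A).mpr hA
  refine isZGroup_of_fixedPointFree (φ := A.normalizerMonoidHom.comp (inclusion hH))
    (fun k hk a ha => ?_) h2
  have hak : (a : G) ∈ A ⊓ centralizer {(k : G)} :=
    ⟨a.2, mem_centralizer_singleton_iff.mpr
      (mul_inv_eq_iff_eq_mul.mp (congrArg Subtype.val ha)).symm⟩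
  rw [h k k.2 (by simpa using hk), mem_bot] at hak
  exact Subtype.ext hak

theorem isInternalSemidirect_sup {N K : Subgroup G} (hK : K ≤ normalizer (N : Set G))
    (hNK : N ⊓ K = ⊥) : IsInternalSemidirect (N ⊔ K) N K :=
  ⟨⟨le_sup_left, le_sup_right, hNK, (coe_mul_of_right_le_normalizer_left N K hK).symm⟩,
    le_normalizer_iff.mp (sup_le le_normalizer hK)⟩

theorem ActsFixedPointFreelyOn.inf_eq_bot {N K : Subgroup G} (h : ActsFixedPointFreelyOn K N) :
    N ⊓ K = ⊥ := by
  refine eq_bot_iff.mpr fun k hk => ?_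
  by_contra hk1
  exact hk1 (h k hk.2 hk1 ▸ ⟨hk.1, mem_centralizer_singleton_iff.mpr rfl⟩)

theorem ActsFixedPointFreelyOn.isFrobeniusGroup_sup {N K : Subgroup G}
    (h : ActsFixedPointFreelyOn K N) (hN : N ≠ ⊥) (hK : K ≠ ⊥)
    (hKN : K ≤ normalizer (N : Set G)) : IsFrobeniusGroup (N ⊔ K) N K := by
  refine ⟨hN, hK, isInternalSemidirect_sup hKN h.inf_eq_bot, fun k hk hk1 n hn hkn => ?_⟩
  rw [← mem_bot, ← h k hk hk1]
  exact ⟨hn, mem_centralizer_singleton_iff.mpr (mul_inv_eq_iff_eq_mul.mp hkn).symm⟩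

theorem actsFaithfullyOn_of_inf_centralizer_eq_bot {Q H : Subgroup G}
    (hQH : Q ≤ normalizer (H : Set G)) (h : Q ⊓ centralizer (H : Set G) = ⊥) :
    ActsFaithfullyOn Q H := by
  refine ⟨le_normalizer_iff.mp hQH, fun q hq hfix => ?_⟩
  rw [← mem_bot, ← h]
  exact ⟨hq, mem_centralizer_iff.mpr fun x hx => (mul_inv_eq_iff_eq_mul.mp (hfix x hx)).symm⟩

/-! ### Coprime action on a group with cyclic Sylow subgroups -/

theorem commutator_normalizer_le_centralizer (F : Subgroup G) [IsCyclic F] :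
    ⁅normalizer (F : Set G), normalizer (F : Set G)⁆ ≤ centralizer (F : Set G) := by
  refine commutator_le.mpr fun x hx y hy => ?_
  have hcomm (σ τ : MulAut F) : ⁅σ, τ⁆ = 1 :=
    (IsCyclic.mulAutMulEquiv F).injective (by
      rw [map_commutatorElement, commutatorElement_eq_one_iff_mul_comm.mpr (mul_comm _ _), map_one])
  let u : normalizer (F : Set G) := ⟨x, hx⟩
  let v : normalizer (F : Set G) := ⟨y, hy⟩
  have hker : ⁅u, v⁆ ∈ F.normalizerMonoidHom.ker := by
    rw [MonoidHom.mem_ker, map_commutatorElement, hcomm]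
  rwa [normalizerMonoidHom_ker, mem_subgroupOf] at hker

theorem normalizer_le_normalizer_map_subtype (H : Subgroup G) (K : Subgroup H)
    [hK : K.Characteristic] : normalizer (H : Set G) ≤ normalizer (K.map H.subtype : Set G) := by
  rw [le_normalizer_iff]
  rintro g hg _ ⟨k, hk, rfl⟩
  refine ⟨H.normalizerMonoidHom ⟨g, hg⟩ k, ?_, rfl⟩
  have := characteristic_iff_map_le.mp hK (H.normalizerMonoidHom ⟨g, hg⟩)
  exact this ⟨k, hk, rfl⟩

open scoped IsMulCommutative in
theorem isCyclic_centralizer_commutator (H : Type*) [Group H] [Finite H] [IsZGroup H] :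
    IsCyclic (centralizer (_root_.commutator H : Set H)) := by
  let f := (Abelianization.of (G := H)).comp (centralizer (_root_.commutator H : Set H)).subtype
  have hker : f.ker ≤ center _ := by
    intro a ha
    have hmem : (a : H) ∈ _root_.commutator H :=
      (Abelianization.ker_of H).le (MonoidHom.mem_ker.mpr ha)
    exact mem_center_iff.mpr fun b => Subtype.ext (mem_centralizer_iff.mp b.2 a hmem).symm
  have := f.isMulCommutative_of_isCyclic_of_ker_le_center hker
  infer_instance

theorem exists_isCyclic_inf_centralizer_le (H : Subgroup G) [Finite H] [IsZGroup H] :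
    ∃ F ≤ H, IsCyclic F ∧ H ⊓ centralizer (F : Set G) ≤ F ∧
      normalizer (H : Set G) ≤ normalizer (F : Set G) := by
  let C : Subgroup H := centralizer (_root_.commutator H : Set H)
  have hC : IsCyclic C := isCyclic_centralizer_commutator H
  have hcommC : _root_.commutator H ≤ C := by
    have := IsZGroup.isCyclic_commutator H
    exact (_root_.commutator H).le_centralizer
  refine ⟨C.map H.subtype, map_subtype_le C,
    isCyclic_of_surjective _ (C.equivMapOfInjective _ H.subtype_injective).surjective, ?_,
    normalizer_le_normalizer_map_subtype H C⟩
  rintro h ⟨hh, hcen⟩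
  refine ⟨⟨h, hh⟩, mem_centralizer_iff.mpr fun c hc => Subtype.ext ?_, rfl⟩
  exact mem_centralizer_iff.mp hcen c ⟨c, hcommC hc, rfl⟩

theorem commutator_le_of_inf_centralizer_le {F H Q : Subgroup G} [IsCyclic F]
    (hself : H ⊓ centralizer (F : Set G) ≤ F) (hHF : H ≤ normalizer (F : Set G))
    (hQF : Q ≤ normalizer (F : Set G)) (hQH : Q ≤ normalizer (H : Set G)) : ⁅H, Q⁆ ≤ F :=
  (le_inf (le_normalizer_iff_commutator_le_left.mp hQH)
    ((commutator_mono hHF hQF).trans (commutator_normalizer_le_centralizer F))).trans hself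

theorem inf_centralizer_eq_bot_of_commutator_le {F H Q : Subgroup G} [Finite F] [Finite Q]
    (hFH : F ≤ H) (hHQ : ⁅H, Q⁆ ≤ F) (hQF : Q ≤ normalizer (F : Set G))
    (hcop : (Nat.card F).Coprime (Nat.card Q)) (hQ : Q ⊓ centralizer (H : Set G) = ⊥) :
    Q ⊓ centralizer (F : Set G) = ⊥ := by
  by_contra hne
  have : Finite (Q ⊓ centralizer (F : Set G) : Subgroup G) :=
    Finite.of_injective _ (inclusion_injective inf_le_left)
  obtain ⟨β, ⟨hβQ, hβF⟩, hβ⟩ := exists_mem_orderOf_prime_of_ne_bot hne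
  have hβZ : zpowers β ≤ Q := zpowers_le.mpr hβQ
  have hsup := le_sup_inf_centralizer hβ
    (hcop.of_dvd_right (Nat.card_zpowers β ▸ card_dvd_of_le hβZ)) (hQF hβQ) hFH
    ((commutator_mono le_rfl hβZ).trans hHQ)
  have hle : F ⊔ H ⊓ centralizer {β} ≤ centralizer {β} :=
    sup_le (fun f hf => mem_centralizer_singleton_iff.mpr (mem_centralizer_iff.mp hβF f hf))
      inf_le_right
  have hβ1 : β ∈ Q ⊓ centralizer (H : Set G) :=
    ⟨hβQ, mem_centralizer_iff.mpr fun h hh =>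
      mem_centralizer_singleton_iff.mp (hle (hsup hh))⟩
  rw [hQ, mem_bot] at hβ1
  exact hβ.ne_one (orderOf_eq_one_iff.mpr hβ1)

theorem commutator_sup_le_of_le_centralizer {F C K : Subgroup G}
    (hCF : C ≤ normalizer (F : Set G)) (hCK : C ≤ centralizer (K : Set G)) :
    ⁅F ⊔ C, K⁆ ≤ ⁅F, K⁆ := by
  refine commutator_le.mpr fun x hx k hk => ?_
  rw [← SetLike.mem_coe, coe_mul_of_right_le_normalizer_left F C hCF] at hx
  obtain ⟨f, hf, c, hc, rfl⟩ := hx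
  have : ⁅f * c, k⁆ = ⁅f, k⁆ := by
    have hck : c * k * c⁻¹ = k :=
      mul_inv_eq_of_eq_mul (mem_centralizer_iff.mp (hCK hc) k hk).symm
    calc ⁅f * c, k⁆ = f * (c * k * c⁻¹) * f⁻¹ * k⁻¹ := by rw [commutatorElement_def]; group
      _ = ⁅f, k⁆ := by rw [hck, commutatorElement_def]
  exact this ▸ commutator_mem_commutator hf hk

theorem isMulCommutative_and_actsFixedPointFreelyOn_commutator {H Q : Subgroup G} [Finite H]
    [Finite Q] [IsZGroup H] (hQH : Q ≤ normalizer (H : Set G))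
    (hcop : (Nat.card H).Coprime (Nat.card Q)) (hQ : Q ⊓ centralizer (H : Set G) = ⊥) :
    IsMulCommutative Q ∧
      ∀ β ∈ Q, (orderOf β).Prime → ActsFixedPointFreelyOn (zpowers β) ⁅H, zpowers β⁆ := by
  obtain ⟨F, hFH, _, hself, hnorm⟩ := exists_isCyclic_inf_centralizer_le H
  have : Finite F := Finite.of_injective _ (inclusion_injective hFH)
  have hHF : H ≤ normalizer (F : Set G) := le_normalizer.trans hnorm
  have hQF : Q ≤ normalizer (F : Set G) := hQH.trans hnorm
  have hHQ : ⁅H, Q⁆ ≤ F := commutator_le_of_inf_centralizer_le hself hHF hQF hQH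
  have hFQ : (Nat.card F).Coprime (Nat.card Q) := hcop.of_dvd_left (card_dvd_of_le hFH)
  refine ⟨commutator_self_eq_bot_iff.mp ?_, fun β hβQ hβ => ?_⟩
  · rw [eq_bot_iff, ← inf_centralizer_eq_bot_of_commutator_le hFH hHQ hQF hFQ hQ]
    exact le_inf Q.commutator_le_self
      ((commutator_mono hQF hQF).trans (commutator_normalizer_le_centralizer F))
  · have hβZ : zpowers β ≤ Q := zpowers_le.mpr hβQ
    have : Finite (zpowers β) := Finite.of_injective _ (inclusion_injective hβZ)
    have hFβ : (Nat.card F).Coprime (Nat.card (zpowers β)) :=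
      hFQ.of_dvd_right (card_dvd_of_le hβZ)
    have hcent : centralizer {β} = centralizer (zpowers β : Set G) := by
      rw [zpowers_eq_closure, centralizer_closure]
    have hsup := le_sup_inf_centralizer hβ (Nat.card_zpowers β ▸ hFβ) (hQF hβQ) hFH
      ((commutator_mono le_rfl hβZ).trans hHQ)
    have hle : ⁅H, zpowers β⁆ ≤ ⁅F, zpowers β⁆ := (commutator_mono hsup le_rfl).trans
      (commutator_sup_le_of_le_centralizer (inf_le_left.trans hHF) (hcent ▸ inf_le_right))
    refine actsFixedPointFreelyOn_zpowers hβ (eq_bot_mono (inf_le_inf_right _ hle) ?_)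
    rw [hcent]
    exact commutator_inf_centralizer_eq_bot (hβZ.trans hQF) hFβ

theorem isDoubleFrobeniusGroup_of_actsFixedPointFreelyOn {A H Q : Subgroup G} [A.Normal]
    (hA : A ≠ ⊥) (hHA : ActsFixedPointFreelyOn H A) (hQH : Q ≤ normalizer (H : Set G))
    (hdisj : (A ⊔ H) ⊓ Q = ⊥) (hQ : Q ⊓ centralizer (H : Set G) = ⊥) {β : G} (hβQ : β ∈ Q)
    (hβ : β ≠ 1) (hfix : ActsFixedPointFreelyOn (zpowers β) ⁅H, zpowers β⁆) :
    IsDoubleFrobeniusGroup (A ⊔ ⁅H, zpowers β⁆ ⊔ zpowers β) A ⁅H, zpowers β⁆ (zpowers β) := by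
  have hβZ : zpowers β ≤ Q := zpowers_le.mpr hβQ
  have hBH : ⁅H, zpowers β⁆ ≤ H := le_normalizer_iff_commutator_le_left.mp (hβZ.trans hQH)
  have hβB : zpowers β ≤ normalizer (⁅H, zpowers β⁆ : Subgroup G) :=
    normalizer_commutator_ge_right _ _
  have hβAB : zpowers β ≤ normalizer (A ⊔ ⁅H, zpowers β⁆ : Subgroup G) := by
    rw [sup_comm]
    exact hβB.trans normalizer_le_normalizer_sup_normal
  have hB : ⁅H, zpowers β⁆ ≠ ⊥ := by
    intro h
    have hβ1 : β ∈ Q ⊓ centralizer (H : Set G) :=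
      ⟨hβQ, le_centralizer_iff.mp (commutator_eq_bot_iff_le_centralizer.mp h) (mem_zpowers β)⟩
    exact hβ (mem_bot.mp (hQ ▸ hβ1))
  refine ⟨isInternalSemidirect_sup hβAB ?_, ?_, ?_⟩
  · exact eq_bot_mono (inf_le_inf (sup_le_sup_left hBH A) hβZ) hdisj
  · exact (hHA.mono_left hBH).isFrobeniusGroup_sup hA hB le_normalizer_of_normal
  · exact hfix.isFrobeniusGroup_sup hB (mt zpowers_eq_bot.mp hβ) hβB

/-! ### T.I. Hall subgroups of `π`-separable groups -/

theorem isPiNumber_compl_primeDivisors_iff {H : Subgroup G} {n : ℕ} :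
    IsPiNumber H.primeDivisorsᶜ n ↔ (Nat.card H).Coprime n :=
  ⟨fun h => Nat.coprime_of_dvd fun p hp hpH hpn => h p hp hpn ⟨hp, hpH⟩,
    fun h _ hp hpn hpH => Nat.not_coprime_of_dvd_of_dvd hp.one_lt hpH.2 hpn h⟩

theorem card_sup_dvd_card_mul_card (N K : Subgroup G) [N.Normal] :
    Nat.card (N ⊔ K : Subgroup G) ∣ Nat.card N * Nat.card K := by
  rw [← relIndex_bot_left, ← relIndex_mul_relIndex ⊥ N (N ⊔ K) bot_le le_sup_left,
    relIndex_bot_left, relIndex_sup_left]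
  exact mul_dvd_mul_left _ (N.relIndex_dvd_card K)

theorem le_piPrimeCore {H N : Subgroup G} [hN : N.Normal]
    (hcop : (Nat.card H).Coprime (Nat.card N)) : N ≤ H.piPrimeCore :=
  le_sSup ⟨hN, isPiNumber_compl_primeDivisors_iff.mpr hcop⟩

theorem coprime_card_piPrimeCore [Finite G] (H : Subgroup G) :
    (Nat.card H).Coprime (Nat.card H.piPrimeCore) := by
  let S : Set (Subgroup G) := {N | N.Normal ∧ IsPiNumber H.primeDivisorsᶜ (Nat.card N)}
  have hS : H.piPrimeCore = S.toFinite.toFinset.sup id := by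
    rw [Finset.sup_id_eq_sSup, Set.Finite.coe_toFinset]
    rfl
  rw [hS]
  refine (Finset.sup_induction
    (p := fun N : Subgroup G => N.Normal ∧ (Nat.card H).Coprime (Nat.card N)) ?_ ?_ ?_).2
  · exact ⟨inferInstance, card_bot (G := G) ▸ Nat.coprime_one_right _⟩
  · rintro M ⟨hM, hM'⟩ N ⟨hN, hN'⟩
    exact ⟨inferInstance, (hM'.mul_right hN').of_dvd_right (card_sup_dvd_card_mul_card M N)⟩
  · intro N hN
    rw [Set.Finite.mem_toFinset] at hN
    exact ⟨hN.1, isPiNumber_compl_primeDivisors_iff.mp hN.2⟩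

theorem mem_normalizer_of_isTI {H : Subgroup G} [Finite H] (hTI : H.IsTI) {x s : G} (hs : s ∈ H)
    (hs1 : s ≠ 1) (hx : x⁻¹ * s * x ∈ H) : x ∈ normalizer (H : Set G) := by
  have hmem (y : G) : y ∈ MulAut.conj x • H ↔ x⁻¹ * y * x ∈ H := by
    rw [mem_pointwise_smul_iff_inv_smul_mem, ← map_inv, MulAut.smul_def, MulAut.conj_apply, inv_inv]
  rcases hTI x with h | h
  · rw [← inv_mem_iff]
    refine mem_normalizer_fintype fun y hy => ?_
    rw [inv_inv]
    exact (hmem y).mp (inf_eq_left.mp h hy)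
  · exact absurd (mem_bot.mp (h ▸ ⟨hs, (hmem s).mpr hx⟩)) hs1

theorem normalizer_le_normalizer_of_isTI {H S : Subgroup G} [Finite H] (hTI : H.IsTI)
    (hS : S ≤ H) (hS1 : S ≠ ⊥) : normalizer (S : Set G) ≤ normalizer (H : Set G) := by
  intro x hx
  obtain ⟨s, hs, hs1⟩ := S.bot_or_exists_ne_one.resolve_left hS1
  exact mem_normalizer_of_isTI hTI (hS hs) hs1 (hS ((mem_normalizer_iff''.mp hx s).mp hs))

theorem exists_sylow_le_of_isTI [Finite G] {H : Subgroup G} (hTI : H.IsTI)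
    (hHall : H.IsHallIn (normalizer (H : Set G))) {p : ℕ} [hp : Fact p.Prime]
    (hpH : p ∣ Nat.card H) : ∃ S : Sylow p G, (S : Subgroup G) ≤ H := by
  obtain ⟨P⟩ : Nonempty (Sylow p H) := inferInstance
  let S : Subgroup G := (P : Subgroup H).map H.subtype
  have hSH : S ≤ H := map_subtype_le _
  have hSp : IsPGroup p S := P.isPGroup'.map H.subtype
  have hSindex : S.relIndex H = (P : Subgroup H).index := by
    rw [relIndex, subgroupOf, comap_map_eq_self_of_injective H.subtype_injective]
  have hS1 : S ≠ ⊥ :=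
    (map_eq_bot_iff_of_injective _ H.subtype_injective).not.mpr (P.ne_bot_of_dvd_card hpH)
  have hdvd : S.relIndex (normalizer (S : Set G)) ∣
      (P : Subgroup H).index * H.relIndex (normalizer (H : Set G)) := by
    rw [← hSindex, relIndex_mul_relIndex S H _ hSH le_normalizer]
    exact relIndex_mul_relIndex S _ _ le_normalizer
      (normalizer_le_normalizer_of_isTI hTI hSH hS1) ▸ dvd_mul_right _ _
  have hpS : ¬ p ∣ S.relIndex (normalizer (S : Set G)) := fun h =>
    (hp.out.dvd_mul.mp (h.trans hdvd)).elim P.not_dvd_index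
      fun h => Nat.not_coprime_of_dvd_of_dvd hp.out.one_lt hpH h hHall.2
  obtain ⟨n, hn⟩ := IsPGroup.iff_card.mp hSp
  have hmod := Sylow.card_quotient_normalizer_modEq_card_quotient hn
  refine ⟨hSp.toSylow fun h => hpS ((hmod.dvd_iff dvd_rfl).mpr ?_), hSH⟩
  rwa [← index_eq_card]

theorem coprime_card_index_of_isTI [Finite G] {H : Subgroup G} (hTI : H.IsTI)
    (hHall : H.IsHallIn (normalizer (H : Set G))) : (Nat.card H).Coprime H.index := by
  refine Nat.coprime_of_dvd fun p hp hpH hpi => ?_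
  have := Fact.mk hp
  obtain ⟨S, hS⟩ := exists_sylow_le_of_isTI hTI hHall hpH
  exact S.not_dvd_index (hpi.trans (index_dvd_of_le hS))

theorem relIndex_sup_of_normal [Finite G] (K M : Subgroup G) [M.Normal] :
    K.relIndex (K ⊔ M) = K.relIndex M := by
  have hM := relIndex_mul_relIndex (M ⊓ K) M (K ⊔ M) inf_le_left le_sup_right
  have hK := relIndex_mul_relIndex (M ⊓ K) K (K ⊔ M) inf_le_right le_sup_left
  rw [inf_relIndex_right, ← relIndex_sup_right (H := K) (K := M)] at hK
  rw [inf_relIndex_left, ← hK, mul_comm] at hM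
  exact (Nat.eq_of_mul_eq_mul_left (Nat.pos_of_ne_zero index_ne_zero_of_finite) hM).symm

theorem relIndex_dvd_index_of_normal_right [Finite G] (K M : Subgroup G) [M.Normal] :
    K.relIndex M ∣ K.index :=
  relIndex_sup_of_normal K M ▸ relIndex_dvd_index_of_le le_sup_left

theorem normalizer_sylow_inf_sup_eq_top [Finite G] {p : ℕ} [Fact p.Prime] (S : Sylow p G)
    (M : Subgroup G) [M.Normal] :
    normalizer (((S : Subgroup G) ⊓ M : Subgroup G) : Set G) ⊔ M = ⊤ := by
  have hdvd : ¬ p ∣ ((S : Subgroup G).subgroupOf M).index := fun h =>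
    S.not_dvd_index (h.trans (relIndex_dvd_index_of_normal_right (S : Subgroup G) M))
  let T : Sylow p M := S.isPGroup'.comap_subtype.toSylow hdvd
  have hT : (T : Subgroup M).map M.subtype = (S : Subgroup G) ⊓ M := subgroupOf_map_subtype _ _
  exact hT ▸ T.normalizer_sup_eq_top

theorem sylow_inf_ne_bot [Finite G] {p : ℕ} [Fact p.Prime] (S : Sylow p G)
    {M : Subgroup G} [M.Normal] (hp : p ∣ Nat.card M) : (S : Subgroup G) ⊓ M ≠ ⊥ := by
  intro h
  have hindex : (S : Subgroup G).relIndex M = Nat.card M := by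
    rw [← inf_relIndex_right, h, relIndex_bot_left]
  rw [← hindex] at hp
  exact S.not_dvd_index (hp.trans (relIndex_dvd_index_of_normal_right _ M))

theorem normalizer_sup_eq_top_of_isTI [Finite G] {H : Subgroup G} (hTI : H.IsTI)
    (hHall : H.IsHallIn (normalizer (H : Set G))) {M : Subgroup G} [M.Normal] {p : ℕ}
    (hp : p.Prime) (hpH : p ∣ Nat.card H) (hpM : p ∣ Nat.card M) :
    normalizer (H : Set G) ⊔ M = ⊤ := by
  have := Fact.mk hp
  obtain ⟨S, hS⟩ := exists_sylow_le_of_isTI hTI hHall hpH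
  rw [← top_le_iff, ← normalizer_sylow_inf_sup_eq_top S M]
  exact sup_le_sup_right (normalizer_le_normalizer_of_isTI hTI (inf_le_left.trans hS)
    (sylow_inf_ne_bot S hpM)) M

theorem piPrimeCore_ne_top [Finite G] {H : Subgroup G} (hH : H ≠ ⊥) : H.piPrimeCore ≠ ⊤ := by
  intro h
  have hcop := coprime_card_piPrimeCore H
  rw [h] at hcop
  exact hH (card_eq_one.mp (Nat.eq_one_of_dvd_coprimes hcop dvd_rfl (card_dvd_of_le le_top)))

theorem exists_normal_gt_piPrimeCore [Finite G] {H : Subgroup G} (hH : H ≠ ⊥)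
    (hsep : IsPiSeparable H.primeDivisors G) :
    ∃ M : Subgroup G, M.Normal ∧ H.piPrimeCore < M ∧
      IsPiNumber H.primeDivisors (H.piPrimeCore.relIndex M) := by
  classical
  obtain ⟨n, N, hN0, hNn, hnormal, hstep⟩ := hsep
  have hex : ∃ j, ¬ N j ≤ H.piPrimeCore :=
    ⟨n, fun h => piPrimeCore_ne_top hH (top_le_iff.mp (hNn ▸ h))⟩
  obtain ⟨i, hi⟩ : ∃ i, Nat.find hex = i + 1 :=
    Nat.exists_eq_succ_of_ne_zero fun h => Nat.find_spec hex (h ▸ hN0 ▸ bot_le)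
  have hiO : N i ≤ H.piPrimeCore := not_not.mp (Nat.find_min hex (hi ▸ i.lt_succ_self))
  have hjO : ¬ N (i + 1) ≤ H.piPrimeCore := hi ▸ Nat.find_spec hex
  have hin : i < n := by
    by_contra! h
    exact Nat.find_min hex (hi ▸ Nat.lt_succ_of_le h)
      fun h => piPrimeCore_ne_top hH (top_le_iff.mp (hNn ▸ h))
  have := hnormal _ hin
  obtain ⟨hle, hpi | hpi'⟩ := hstep i hin
  · refine ⟨N (i + 1) ⊔ H.piPrimeCore, inferInstance, right_lt_sup.mpr hjO, fun p hp hpr => ?_⟩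
    rw [relIndex_sup_right] at hpr
    exact hpi p hp (hpr.trans (relIndex_dvd_of_le_left _ hiO))
  · refine absurd (le_piPrimeCore ?_) hjO
    rw [← relIndex_bot_left (N (i + 1)), ← relIndex_mul_relIndex ⊥ (N i) _ bot_le hle,
      relIndex_bot_left]
    exact ((coprime_card_piPrimeCore H).of_dvd_right (card_dvd_of_le hiO)).mul_right
      (isPiNumber_compl_primeDivisors_iff.mp hpi')

theorem normalizer_sup_piPrimeCore_eq_top [Finite G] {H : Subgroup G} (hTI : H.IsTI)
    (hHall : H.IsHallIn (normalizer (H : Set G))) (hH : H ≠ ⊥)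
    (hsep : IsPiSeparable H.primeDivisors G) :
    normalizer (H : Set G) ⊔ H.piPrimeCore = ⊤ := by
  obtain ⟨M, hM, hOM, hpi⟩ := exists_normal_gt_piPrimeCore hH hsep
  obtain ⟨p, hp, hpr⟩ := Nat.exists_prime_and_dvd (mt relIndex_eq_one.mp hOM.not_ge)
  have hNM : normalizer (H : Set G) ⊔ M = ⊤ :=
    normalizer_sup_eq_top_of_isTI hTI hHall hp (hpi p hp hpr).2
      (hpr.trans (relIndex_dvd_card _ _))
  let K : Subgroup G := normalizer (H : Set G) ⊔ H.piPrimeCore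
  have hKM : K ⊔ M = ⊤ := top_le_iff.mp (hNM ▸ sup_le_sup_right le_sup_left M)
  have hindex : K.index = K.relIndex M := by
    rw [← relIndex_sup_of_normal, hKM, relIndex_top_right]
  by_contra hne
  obtain ⟨q, hq, hqK⟩ := Nat.exists_prime_and_dvd (mt index_eq_one.mp hne)
  have hqH : q ∣ Nat.card H :=
    (hpi q hq ((hindex ▸ hqK).trans (relIndex_dvd_of_le_left _ le_sup_right))).2
  exact Nat.not_coprime_of_dvd_of_dvd hq.one_lt hqH
    (hqK.trans (index_dvd_of_le (le_normalizer.trans le_sup_left)))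
    (coprime_card_index_of_isTI hTI hHall)

theorem coprime_card_of_isComplementIn {H Q K : Subgroup G}
    (hQ : Q.IsComplementIn H K) (hHall : H.IsHallIn K) (hK : K ≤ normalizer (H : Set G)) :
    (Nat.card H).Coprime (Nat.card Q) := by
  refine hHall.2.of_dvd_right ?_
  have : (H.subgroupOf K).Normal := normal_subgroupOf_of_le_normalizer hK
  have hdvd := relIndex_dvd_index_of_normal (H.subgroupOf K) (Q.subgroupOf K)
  rwa [relIndex_subgroupOf hQ.2.1, ← inf_relIndex_right, hQ.2.2.1, relIndex_bot_left] at hdvd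

/-! ### The quotient by the derived subgroup of the core -/

theorem sup_eq_of_isComplementIn {H Q K : Subgroup G} (hQ : Q.IsComplementIn H K) :
    H ⊔ Q = K := by
  refine le_antisymm (sup_le hQ.1 hQ.2.1) fun x hx => ?_
  obtain ⟨h, hh, q, hq, rfl⟩ : x ∈ (H : Set G) * (Q : Set G) := hQ.2.2.2 ▸ hx
  exact mul_mem_sup hh hq

theorem isMulCommutative_map_mk'_commutator (O : Subgroup G) [O.Normal] :
    IsMulCommutative (O.map (QuotientGroup.mk' ⁅O, O⁆)) := by
  rw [← commutator_self_eq_bot_iff, ← map_commutator, Subgroup.map_eq_bot_iff,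
    QuotientGroup.ker_mk']

theorem inf_normalizer_le_centralizer {N H : Subgroup G} [N.Normal] (hNH : N ⊓ H = ⊥) :
    N ⊓ normalizer (H : Set G) ≤ centralizer (H : Set G) := by
  rw [← commutator_eq_bot_iff_le_centralizer, eq_bot_iff, ← hNH]
  exact le_inf ((commutator_mono inf_le_left le_rfl).trans (commutator_le_left N H))
    ((commutator_mono inf_le_right le_rfl).trans
      (le_normalizer_iff_commutator_le_right.mp le_rfl))

theorem inf_normalizer_le_commutator {O H : Subgroup G} [Finite O] [Finite H] [O.Normal]
    (hcop : (Nat.card O).Coprime (Nat.card H)) (hOH : ⁅O, H⁆ = O) :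
    O ⊓ normalizer (H : Set G) ≤ ⁅O, O⁆ := by
  intro x hx
  let φ := QuotientGroup.mk' ⁅O, O⁆
  have : IsMulCommutative (O.map φ) := isMulCommutative_map_mk'_commutator O
  have : (O.map φ).Normal := .map ‹_› φ (QuotientGroup.mk'_surjective _)
  have : Finite (O.map φ) := Finite.of_surjective _ (φ.subgroupMap_surjective O)
  have : Finite (H.map φ) := Finite.of_surjective _ (φ.subgroupMap_surjective H)
  have hφx : φ x ∈ ⁅O.map φ, H.map φ⁆ ⊓ centralizer (H.map φ : Set (G ⧸ ⁅O, O⁆)) := by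
    rw [← map_commutator, hOH]
    exact ⟨mem_map_of_mem φ hx.1, map_centralizer_le_centralizer_image _ φ (mem_map_of_mem φ
      (inf_normalizer_le_centralizer (inf_eq_bot_of_coprime_card hcop) hx))⟩
  rwa [commutator_inf_centralizer_eq_bot le_normalizer_of_normal
    (hcop.of_dvd (card_map_dvd O φ) (card_map_dvd H φ)), mem_bot,
    ← MonoidHom.mem_ker, QuotientGroup.ker_mk'] at hφx

/-- A commuting pair in `G ⧸ D` lifts to a commuting pair in `G` because `|H|` and `|D|` are
coprime; the T.I. property then puts the lift in the normalizer of `H`. -/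
theorem actsFixedPointFreelyOn_map_mk'_of_isTI {D O H : Subgroup G} [Finite D] [Finite H]
    [D.Normal] (hTI : H.IsTI) (hDO : D ≤ O) (hcop : (Nat.card H).Coprime (Nat.card D))
    (hO : O ⊓ normalizer (H : Set G) ≤ D) :
    ActsFixedPointFreelyOn (H.map (QuotientGroup.mk' D)) (O.map (QuotientGroup.mk' D)) := by
  have : Finite (H.map (QuotientGroup.mk' D)) :=
    Finite.of_surjective _ ((QuotientGroup.mk' D).subgroupMap_surjective H)
  refine actsFixedPointFreelyOn_of_orderOf_prime ?_
  rintro _ ⟨h, hh, rfl⟩ hp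
  rw [eq_bot_iff]
  rintro _ ⟨⟨x, hx, rfl⟩, hcomm⟩
  set φ := QuotientGroup.mk' D
  have hmem {y : G} : φ y = 1 ↔ y ∈ D := QuotientGroup.eq_one_iff y
  have := Fact.mk hp
  have hpD : ¬ orderOf (φ h) ∣ Nat.card D :=
    fun hd => Nat.not_coprime_of_dvd_of_dvd hp.one_lt
      ((orderOf_map_dvd φ h).trans (H.orderOf_dvd_natCard hh)) hd hcop
  have hpow : h ^ orderOf (φ h) ^ 1 = 1 := by
    rw [← mem_bot, ← inf_eq_bot_of_coprime_card hcop, pow_one]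
    exact ⟨pow_mem hh _, hmem.mp (by rw [map_pow, pow_orderOf_eq_one])⟩
  have hxh : ⁅x⁻¹, h⁆ ∈ D := by
    rw [← hmem, map_commutatorElement, map_inv, commutatorElement_eq_one_iff_commute]
    exact Commute.inv_left (mem_centralizer_singleton_iff.mp hcomm)
  obtain ⟨c, hxc, hc⟩ := exists_commute_of_commutatorElement_mem hpD hpow
    (le_normalizer_of_normal (mem_top h)) hxh
  have hcO : c ∈ O := (mul_mem_cancel_left (inv_mem hx)).mp (hDO hxc)
  have hcD : c ∈ D := hO ⟨hcO, mem_normalizer_of_isTI hTI hh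
    (fun h1 => hp.ne_one (by rw [h1, map_one, orderOf_one])) (by
      rwa [mul_assoc, hc.eq, inv_mul_cancel_left])⟩
  exact hmem.mpr (inv_mem_iff.mp ((mul_mem_cancel_right hcD).mp hxc))

theorem sup_inf_le_of_coprime_card {N H Q : Subgroup G} [Finite H] [N.Normal]
    (hcop : (Nat.card H).Coprime (Nat.card Q)) : (N ⊔ H) ⊓ Q ≤ N := by
  let φ := QuotientGroup.mk' N
  have : Finite (H.map φ) := Finite.of_surjective _ (φ.subgroupMap_surjective H)
  have hbot : H.map φ ⊓ Q.map φ = ⊥ :=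
    inf_eq_bot_of_coprime_card (hcop.of_dvd (card_map_dvd H φ) (card_map_dvd Q φ))
  have hN : N.map φ = ⊥ := (Subgroup.map_eq_bot_iff _).mpr (QuotientGroup.ker_mk' N).ge
  have hmap : ((N ⊔ H) ⊓ Q).map φ = ⊥ := by
    refine eq_bot_mono (map_inf_le _ _ φ) ?_
    rwa [Subgroup.map_sup, hN, bot_sup_eq]
  exact ((Subgroup.map_eq_bot_iff _).mp hmap).trans_eq (QuotientGroup.ker_mk' N)

theorem map_sup_inf_map_eq_bot {D O H Q : Subgroup G} [Finite H] [D.Normal] [O.Normal]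
    (hDO : D ≤ O) (hcop : (Nat.card H).Coprime (Nat.card Q)) (hOQ : O ⊓ Q ≤ D) :
    (O.map (QuotientGroup.mk' D) ⊔ H.map (QuotientGroup.mk' D)) ⊓
      Q.map (QuotientGroup.mk' D) = ⊥ := by
  have hD : (QuotientGroup.mk' D).ker = D := QuotientGroup.ker_mk' D
  have hle : (O ⊔ H) ⊓ Q ≤ D := (le_inf (sup_inf_le_of_coprime_card hcop) inf_le_right).trans hOQ
  rw [← Subgroup.map_sup, eq_bot_iff]
  rintro _ ⟨hx, q, hq, rfl⟩
  have hqOH : q ∈ ((O ⊔ H).map (QuotientGroup.mk' D)).comap (QuotientGroup.mk' D) := hx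
  rw [comap_map_eq_self (hD.le.trans (hDO.trans le_sup_left))] at hqOH
  rw [mem_bot, ← MonoidHom.mem_ker, hD]
  exact hle ⟨hqOH, hq⟩

theorem normalizer_le_normalizer_centralizer (H : Subgroup G) :
    normalizer (H : Set G) ≤ normalizer (centralizer (H : Set G) : Set G) := by
  refine le_normalizer_iff.mpr fun g hg x hx => mem_centralizer_iff.mpr fun h hh => ?_
  have hcomm := mem_centralizer_iff.mp hx _ ((mem_normalizer_iff''.mp hg h).mp hh)
  calc h * (g * x * g⁻¹) = g * (g⁻¹ * h * g * x) * g⁻¹ := by group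
    _ = g * x * g⁻¹ * h := by rw [hcomm]; group

theorem normal_sup_inf_centralizer {A H Q : Subgroup G} [A.Normal]
    (hQH : Q ≤ normalizer (H : Set G)) (htop : A ⊔ H ⊔ Q = ⊤) :
    (A ⊔ Q ⊓ centralizer (H : Set G)).Normal := by
  have hHK : H ≤ normalizer ((Q ⊓ centralizer (H : Set G) : Subgroup G) : Set G) :=
    (le_centralizer_iff.mp inf_le_right).trans (centralizer_le_normalizer _)
  have hQK : Q ≤ normalizer ((Q ⊓ centralizer (H : Set G) : Subgroup G) : Set G) :=
    (le_inf le_normalizer (hQH.trans (normalizer_le_normalizer_centralizer H))).trans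
      inf_normalizer_le_normalizer_inf
  rw [← normalizer_eq_top_iff, ← top_le_iff, ← htop, sup_assoc, sup_comm A (Q ⊓ _)]
  exact sup_le (le_sup_right.trans le_normalizer)
    ((sup_le hHK hQK).trans normalizer_le_normalizer_sup_normal)

theorem card_comap_mk' (N : Subgroup G) [N.Normal] (L : Subgroup (G ⧸ N)) :
    Nat.card (L.comap (QuotientGroup.mk' N)) = Nat.card N * Nat.card L := by
  have hN : N ≤ L.comap (QuotientGroup.mk' N) := QuotientGroup.le_comap_mk' N L
  have hrel := relIndex_ker (K := L.comap (QuotientGroup.mk' N)) (QuotientGroup.mk' N)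
  rw [QuotientGroup.ker_mk', map_comap_eq_self_of_surjective (QuotientGroup.mk'_surjective N)]
    at hrel
  rw [← relIndex_bot_left, ← relIndex_mul_relIndex ⊥ N _ bot_le hN, relIndex_bot_left, hrel]

theorem le_map_mk'_piPrimeCore [Finite G] {H D : Subgroup G} [D.Normal] (hD : D ≤ H.piPrimeCore)
    {L : Subgroup (G ⧸ D)} [hL : L.Normal] (hcop : (Nat.card H).Coprime (Nat.card L)) :
    L ≤ H.piPrimeCore.map (QuotientGroup.mk' D) := by
  have : (L.comap (QuotientGroup.mk' D)).Normal := hL.comap _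
  rw [← map_comap_eq_self_of_surjective (QuotientGroup.mk'_surjective D) L]
  refine map_mono (le_piPrimeCore ?_)
  rw [card_comap_mk']
  exact ((coprime_card_piPrimeCore H).of_dvd_right (card_dvd_of_le hD)).mul_right hcop

theorem isCyclic_sylow_of_surjective {K : Type*} [Group K] [Finite G] {p : ℕ} [Fact p.Prime]
    {f : G →* K} (hf : Function.Surjective f) (h : ∀ P : Sylow p G, IsCyclic P) (P : Sylow p K) :
    IsCyclic P := by
  obtain ⟨S, rfl⟩ := Sylow.mapSurjective_surjective hf p P
  have := h S
  exact isCyclic_of_surjective (f.subgroupMap S) (f.subgroupMap_surjective S)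

theorem map_inf_centralizer_map_eq_bot [Finite G] {H Q D : Subgroup G} [D.Normal]
    (hD : D ≤ H.piPrimeCore) (hQH : Q ≤ normalizer (H : Set G))
    (hcop : (Nat.card H).Coprime (Nat.card Q)) (htop : H.piPrimeCore ⊔ H ⊔ Q = ⊤)
    (hdisj : H.piPrimeCore.map (QuotientGroup.mk' D) ⊓ Q.map (QuotientGroup.mk' D) = ⊥) :
    Q.map (QuotientGroup.mk' D) ⊓
      centralizer (H.map (QuotientGroup.mk' D) : Set (G ⧸ D)) = ⊥ := by
  set φ := QuotientGroup.mk' D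
  have hφ : Function.Surjective φ := QuotientGroup.mk'_surjective D
  have : (H.piPrimeCore.map φ).Normal := .map inferInstance φ hφ
  have htop' : H.piPrimeCore.map φ ⊔ H.map φ ⊔ Q.map φ = ⊤ := by
    rw [← Subgroup.map_sup, ← Subgroup.map_sup, htop, map_top_of_surjective φ hφ]
  have hnormal := normal_sup_inf_centralizer ((map_mono hQH).trans (le_normalizer_map φ)) htop'
  have hle := le_sup_right.trans <| le_map_mk'_piPrimeCore hD <|
    (((coprime_card_piPrimeCore H).of_dvd_right (card_map_dvd _ φ)).mul_right
      (hcop.of_dvd_right ((card_dvd_of_le inf_le_left).trans (card_map_dvd Q φ)))).of_dvd_right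
      (card_sup_dvd_card_mul_card _ (Q.map φ ⊓ centralizer (H.map φ : Set (G ⧸ D))))
  exact eq_bot_mono (le_inf hle inf_le_left) hdisj

theorem isInternalSemidirect_top_of_sup_eq_top {A H Q : Subgroup G} [A.Normal]
    (hQH : Q ≤ normalizer (H : Set G)) (htop : A ⊔ H ⊔ Q = ⊤) (hdisj : (A ⊔ H) ⊓ Q = ⊥) :
    IsInternalSemidirect ⊤ (A ⊔ H) Q := by
  rw [← htop]
  refine isInternalSemidirect_sup ?_ hdisj
  rw [sup_comm]
  exact hQH.trans normalizer_le_normalizer_sup_normal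

theorem isInternalSemidirect_and_actsFaithfullyOn_and_isDoubleFrobeniusGroup
    {A H Q : Subgroup G} [Finite A] [Finite H] [Finite Q] [A.Normal] [IsMulCommutative A]
    (hA : A ≠ ⊥) (hHA : ActsFixedPointFreelyOn H A)
    (h2 : ∀ P : Sylow 2 H, IsCyclic P) (hQH : Q ≤ normalizer (H : Set G))
    (hcop : (Nat.card H).Coprime (Nat.card Q)) (htop : A ⊔ H ⊔ Q = ⊤)
    (hdisj : (A ⊔ H) ⊓ Q = ⊥) (hQ : Q ⊓ centralizer (H : Set G) = ⊥) :
    (IsInternalSemidirect (A ⊔ H) A H ∧ IsInternalSemidirect ⊤ (A ⊔ H) Q) ∧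
    ((∀ x ∈ Q, ∀ y ∈ Q, x * y = y * x) ∧ Q.ActsFaithfullyOn H) ∧
    ∀ β ∈ Q, (orderOf β).Prime →
      IsDoubleFrobeniusGroup (A ⊔ ⁅H, zpowers β⁆ ⊔ zpowers β) A ⁅H, zpowers β⁆ (zpowers β) := by
  have : IsZGroup H := hHA.isZGroup hA le_normalizer_of_normal h2
  obtain ⟨hcomm, hfix⟩ :=
    isMulCommutative_and_actsFixedPointFreelyOn_commutator hQH hcop hQ
  refine ⟨⟨isInternalSemidirect_sup le_normalizer_of_normal hHA.inf_eq_bot,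
      isInternalSemidirect_top_of_sup_eq_top hQH htop hdisj⟩,
    ⟨fun _ hx _ hy => setLike_mul_comm hx hy,
      actsFaithfullyOn_of_inf_centralizer_eq_bot hQH hQ⟩, fun β hβQ hβ => ?_⟩
  exact isDoubleFrobeniusGroup_of_actsFixedPointFreelyOn hA hHA hQH hdisj hQ hβQ
    (mt orderOf_eq_one_iff.mpr hβ.ne_one) (hfix β hβQ hβ)

theorem mainTheorem6_general [Finite G] (H Q : Subgroup G) (hTI : H.IsTI)
    (hsep : IsPiSeparable H.primeDivisors G)
    (hHall : H.IsHallIn (normalizer (H : Set G)))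
    (hQ : Q.IsComplementIn H (normalizer (H : Set G)))
    (h2 : ∀ P : Sylow 2 H, IsCyclic P)
    (hOH : ⁅H.piPrimeCore, H⁆ = H.piPrimeCore)
    (hOO : ⁅H.piPrimeCore, H.piPrimeCore⁆ ≠ H.piPrimeCore)
    (Obar Hbar Qbar : Subgroup (G ⧸ ⁅H.piPrimeCore, H.piPrimeCore⁆))
    (hObar : Obar = H.piPrimeCore.map (QuotientGroup.mk' ⁅H.piPrimeCore, H.piPrimeCore⁆))
    (hHbar : Hbar = H.map (QuotientGroup.mk' ⁅H.piPrimeCore, H.piPrimeCore⁆))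
    (hQbar : Qbar = Q.map (QuotientGroup.mk' ⁅H.piPrimeCore, H.piPrimeCore⁆)) :
    (IsInternalSemidirect (Obar ⊔ Hbar) Obar Hbar ∧
      IsInternalSemidirect ⊤ (Obar ⊔ Hbar) Qbar) ∧
    ((∀ x ∈ Qbar, ∀ y ∈ Qbar, x * y = y * x) ∧ Qbar.ActsFaithfullyOn Hbar) ∧
    ∀ β ∈ Qbar, (orderOf β).Prime →
      IsDoubleFrobeniusGroup (Obar ⊔ ⁅Hbar, zpowers β⁆ ⊔ zpowers β)
        Obar ⁅Hbar, zpowers β⁆ (zpowers β) := by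
  set O := H.piPrimeCore
  set φ := QuotientGroup.mk' ⁅O, O⁆
  have hφ : Function.Surjective φ := QuotientGroup.mk'_surjective _
  have hDO : ⁅O, O⁆ ≤ O := commutator_le_self O
  have hQH : Q ≤ normalizer (H : Set G) := hQ.2.1
  have hcop : (Nat.card H).Coprime (Nat.card O) := coprime_card_piPrimeCore H
  have hcopQ := coprime_card_of_isComplementIn hQ hHall le_rfl
  have hH : H ≠ ⊥ := fun h => hOO <| by
    rw [h, commutator_bot_right] at hOH
    exact hOH ▸ commutator_bot_left _
  have htop : O ⊔ H ⊔ Q = ⊤ := by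
    rw [sup_assoc, sup_eq_of_isComplementIn hQ, sup_comm,
      normalizer_sup_piPrimeCore_eq_top hTI hHall hH hsep]
  have hfix : O ⊓ normalizer (H : Set G) ≤ ⁅O, O⁆ := inf_normalizer_le_commutator hcop.symm hOH
  have hdisj : (O.map φ ⊔ H.map φ) ⊓ Q.map φ = ⊥ :=
    map_sup_inf_map_eq_bot hDO hcopQ ((inf_le_inf_left O hQH).trans hfix)
  have : IsMulCommutative (O.map φ) := isMulCommutative_map_mk'_commutator O
  have : (O.map φ).Normal := .map inferInstance φ hφ
  have hO : O.map φ ≠ ⊥ := fun h => hOO <| hDO.antisymm <|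
    ((Subgroup.map_eq_bot_iff _).mp h).trans_eq (QuotientGroup.ker_mk' _)
  have hHO : ActsFixedPointFreelyOn (H.map φ) (O.map φ) :=
    actsFixedPointFreelyOn_map_mk'_of_isTI hTI hDO (hcop.of_dvd_right (card_dvd_of_le hDO)) hfix
  have hQ1 : Q.map φ ⊓ centralizer (H.map φ : Set (G ⧸ ⁅O, O⁆)) = ⊥ :=
    map_inf_centralizer_map_eq_bot hDO hQH hcopQ htop
      (eq_bot_mono (inf_le_inf_right _ le_sup_left) hdisj)
  subst hObar hHbar hQbar
  exact isInternalSemidirect_and_actsFaithfullyOn_and_isDoubleFrobeniusGroup hO hHO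
    (isCyclic_sylow_of_surjective (φ.subgroupMap_surjective H) h2)
    ((map_mono hQH).trans (le_normalizer_map φ))
    (hcopQ.of_dvd (card_map_dvd H φ) (card_map_dvd Q φ))
    (by rw [← Subgroup.map_sup, ← Subgroup.map_sup, htop, map_top_of_surjective φ hφ]) hdisj hQ1

theorem isCyclic_sylow_two_of_odd_card {H : Type*} [Group H] (hodd : Odd (Nat.card H))
    (P : Sylow 2 H) : IsCyclic P := by
  have : Finite H := Nat.finite_of_card_ne_zero hodd.pos.ne'
  have hcard : Nat.card P = 1 := P.isPGroup'.card_eq_or_dvd.resolve_right fun h =>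
    hodd.not_two_dvd_nat (h.trans (card_subgroup_dvd_card _))
  have : Subsingleton P := (Nat.card_eq_one_iff_unique.mp hcard).1
  exact isCyclic_of_subsingleton

theorem commutator_ne_self_of_isSolvable {O : Subgroup G} [Group.IsSolvable O] (hO : O ≠ ⊥) :
    ⁅O, O⁆ ≠ O := by
  intro h
  have : Nontrivial O := (nontrivial_iff_ne_bot O).mpr hO
  refine (Group.IsSolvable.commutator_lt_of_ne_bot (G := O) top_ne_bot).ne
    (map_injective O.subtype_injective ?_)
  rw [map_commutator, ← MonoidHom.range_eq_map, range_subtype, h]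

theorem piPrimeCore_ne_bot_of_not_normal [Finite G] {H : Subgroup G} (hTI : H.IsTI)
    (hH : ¬ H.Normal) (hsep : IsPiSeparable H.primeDivisors G)
    (hHall : H.IsHallIn (normalizer (H : Set G))) : H.piPrimeCore ≠ ⊥ := by
  intro h
  have hsup := normalizer_sup_piPrimeCore_eq_top hTI hHall (fun h => hH (h ▸ inferInstance)) hsep
  rw [h, sup_bot_eq] at hsup
  exact hH (normalizer_eq_top_iff.mp hsup)

end

theorem mainTheorem6 {G : Type*} [Group G] [Finite G] (H Q : Subgroup G)
    (hTI : H.IsTI) (hnn : ¬ H.Normal)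
    (hsep : IsPiSeparable H.primeDivisors G)
    (hHall : H.IsHallIn (Subgroup.normalizer (H : Set G)))
    (hQ : Q.IsComplementIn H (Subgroup.normalizer (H : Set G)))
    (hodd : Odd (Nat.card H))
    (hOH : ⁅H.piPrimeCore, H⁆ = H.piPrimeCore)
    (hsolv : Group.IsSolvable H.piPrimeCore)
    (hQO : ¬ Q ≤ ⁅H.piPrimeCore, H.piPrimeCore⁆)
    (Obar Hbar Qbar : Subgroup (G ⧸ ⁅H.piPrimeCore, H.piPrimeCore⁆))
    (hObar : Obar = H.piPrimeCore.map (QuotientGroup.mk' ⁅H.piPrimeCore, H.piPrimeCore⁆))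
    (hHbar : Hbar = H.map (QuotientGroup.mk' ⁅H.piPrimeCore, H.piPrimeCore⁆))
    (hQbar : Qbar = Q.map (QuotientGroup.mk' ⁅H.piPrimeCore, H.piPrimeCore⁆)) :
    (Subgroup.IsInternalSemidirect (Obar ⊔ Hbar) Obar Hbar ∧
      Subgroup.IsInternalSemidirect ⊤ (Obar ⊔ Hbar) Qbar) ∧
    ((∀ x ∈ Qbar, ∀ y ∈ Qbar, x * y = y * x) ∧ Qbar.ActsFaithfullyOn Hbar) ∧
    ∀ β ∈ Qbar, (orderOf β).Prime →
      Subgroup.IsDoubleFrobeniusGroup (Obar ⊔ ⁅Hbar, Subgroup.zpowers β⁆ ⊔ Subgroup.zpowers β)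
        Obar ⁅Hbar, Subgroup.zpowers β⁆ (Subgroup.zpowers β) :=
  mainTheorem6_general H Q hTI hsep hHall hQ (isCyclic_sylow_two_of_odd_card hodd) hOH
    (commutator_ne_self_of_isSolvable (piPrimeCore_ne_bot_of_not_normal hTI hnn hsep hHall))
    Obar Hbar Qbar hObar hHbar hQbar
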